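/- Let $X,Y$ be finite-dimensional complex Hilbert spaces with fixed orthonormal bases, and let $G$ be a finite group with arbitrary linear representations $\rho_X:G\to \mathrm{GL}(X)$ and $\rho_Y:G\to\mathrm{GL}(Y)$. For a representation $\tau$ of a group $K$ on $\mathcal H$, let $\mathrm{End}^{K}(\mathcal H)$ denote the algebra of linear operators on $\mathcal H$ commuting with $\tau(g)$ for all $g\in K$. For a linear map $\mathcal N:\mathscr L(X)\to\mathscr L(Y)$ let $J^{\mathcal N}=\sum_{x,x'}|x\rangle\langle x'|\otimes\mathcal N(|x\rangle\langle x'|)$ be its Choi matrix. For $t\in(0,1)$ and positive definite $A,B$ put $A\#_tB=A^{1/2}(A^{-1/2}BA^{-1/2})^tA^{1/2}$, and for positive semidefinite $A,B$ put $A\#_tB=\lim_{\varepsilon\downarrow0}(A+\varepsilon I)\#_t(B+\varepsilon I)$. Let $\mathcal N,\mathcal M$ be quantum channels (completely positive trace-preserving maps) from $\mathscr L(X)$ to $\mathscr L(Y)$ such that $J^{\mathcal N},J^{\mathcal M}\in\mathrm{End}^G(X\otimes Y)$ for the representation $\rho_X\otimes\rho_Y$, and such that $\mathrm{supp}(J^{\mathcal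 N})\subseteq\mathrm{supp}(J^{\mathcal M})$, where the support of an operator is the orthogonal complement of its kernel. Let $\alpha\in(1,\infty)$ and $k\in\mathbb N$, and let $H=G^k\rtimes\mathfrak S_k$ be the semidirect product with multiplication $(g',\pi')(g,\pi)=\big((g'_i\,g_{\pi'^{-1}(i)})_{i},\ \pi'\pi\big)$. For $\mathcal H\in\{X,Y\}$ it acts on $\mathcal H^{\otimes k}$ by $(g,\pi)\cdot(h_1\otimes\cdots\otimes h_k)=\rho_{\mathcal H}(g_1)h_{\pi^{-1}(1)}\otimes\cdots\otimes\rho_{\mathcal H}(g_k)h_{\pi^{-1}(k)}$, and on $X^{\otimes k}\otimes Y^{\otimes k}$ by the tensor product of these two actions. Then the program $$\min_{A\ge0}\ \|\mathrm{tr}_{Y^{\otimes k}}(A)\|_\infty\quad\text{s.t.}\quad J^{\mathcal N^{\otimes k}}\le J^{\mathcal M^{\otimes k}}\,\#_{1/\alpha}\,A ,$$ over operators $A$ on $X^{\otimes k}\otimes Y^{\otimes k}$, where $\|\cdot\|_\infty$ is the operator norm (so that $D^{\#}_\alpha(\mathcal N^{\otimes k}\|\mathcal M^{\otimes k})$ is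 $\frac1{\alpha-1}\log$ of its optimal value), has an optimal solution $A\in\mathrm{End}^{H}(X^{\otimes k}\otimes Y^{\otimes k})$. -/

import Mathlib

open scoped Matrix MatrixOrder ComplexOrder Kronecker Topology CStarAlgebra Matrix.Norms.L2Operator

noncomputable section

namespace SharpDivergence

/-! Finite-dimensional Hilbert spaces with their standard bases are `ℂ^X`, `ℂ^Y` for finite index
types `X`, `Y`. Operators are complex matrices; `X ⊗ Y` is indexed by `X × Y`, `X^{⊗k}` is indexed
by `Fin k → X`, and `X^{⊗k} ⊗ Y^{⊗k}` by `(Fin k → X) × (Fin k → Y)`. Matrices carry the Loewner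
order, and `‖ ‖` on matrices is the operator norm of the Euclidean norms. -/

variable {X Y n G : Type*} [Fintype X] [DecidableEq X] [Fintype Y] [DecidableEq Y]
  [Fintype n] [DecidableEq n] [Group G]

/-- A quantum channel: a completely positive and trace-preserving linear map. -/
def IsQuantumChannel (N : Matrix X X ℂ →CP Matrix Y Y ℂ) : Prop :=
  ∀ R : Matrix X X ℂ, (N R).trace = R.trace

/-- The Choi matrix `(id ⊗ N)(|Φ⟩⟨Φ|)`, `|Φ⟩ = ∑ x, |x⟩|x⟩`: its block at `x, x'` is
`N (|x⟩⟨x'|)`. -/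
def choi (N : Matrix X X ℂ →ₗ[ℂ] Matrix Y Y ℂ) : Matrix (X × Y) (X × Y) ℂ :=
  Matrix.of fun p q => N (Matrix.single p.1 q.1 1) p.2 q.2

/-- The tensor product `R 0 ⊗ ⋯ ⊗ R (k-1)` of `k` matrices. -/
def piKron {k : ℕ} (R : Fin k → Matrix X X ℂ) : Matrix (Fin k → X) (Fin k → X) ℂ :=
  Matrix.of fun x x' => ∏ i, R i (x i) (x' i)

/-- The tensor power `N^{⊗k}` of a linear map on matrices: the linear map that sends
`|x⟩⟨x'| = ⨂ i, |x i⟩⟨x' i|` to `⨂ i, N (|x i⟩⟨x' i|)`. -/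
def tensorPow (k : ℕ) (N : Matrix X X ℂ →ₗ[ℂ] Matrix Y Y ℂ) :
    Matrix (Fin k → X) (Fin k → X) ℂ →ₗ[ℂ] Matrix (Fin k → Y) (Fin k → Y) ℂ where
  toFun R := ∑ x, ∑ x', R x x' • piKron fun i => N (Matrix.single (x i) (x' i) 1)
  map_add' R S := by simp [add_smul, Finset.sum_add_distrib]
  map_smul' c R := by simp [mul_smul, Finset.smul_sum]

/-- `N^{⊗k}` acts factorwise on product matrices. -/
theorem tensorPow_piKron (k : ℕ) (N : Matrix X X ℂ →ₗ[ℂ] Matrix Y Y ℂ)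
    (R : Fin k → Matrix X X ℂ) :
    tensorPow k N (piKron R) = piKron fun i => N (R i) := by
  have key : ∀ S : Matrix X X ℂ, N S = ∑ x, ∑ x', S x x' • N (Matrix.single x x' 1) := by
    intro S
    conv_lhs => rw [Matrix.matrix_eq_sum_single S]
    simp only [map_sum]
    refine Finset.sum_congr rfl fun x _ => Finset.sum_congr rfl fun x' _ => ?_
    rw [← map_smul, Matrix.smul_single, smul_eq_mul, mul_one]
  ext y y'
  simp only [tensorPow, LinearMap.coe_mk, AddHom.coe_mk, piKron, Matrix.sum_apply,
    Matrix.smul_apply, Matrix.of_apply, smul_eq_mul]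
  conv_rhs =>
    enter [2, i]
    rw [key (R i)]
  simp only [Matrix.sum_apply, Matrix.smul_apply, smul_eq_mul, Finset.prod_univ_sum,
    Fintype.piFinset_univ, ← Finset.prod_mul_distrib]

/-- The partial trace `tr_Y`. -/
def traceY (A : Matrix (X × Y) (X × Y) ℂ) : Matrix X X ℂ :=
  Matrix.of fun x x' => ∑ y, A (x, y) (x', y)

/-- The weighted geometric mean `A^{1/2} (A^{-1/2} B A^{-1/2})^t A^{1/2}` of positive definite
matrices. -/
def geomMeanPD (t : ℝ) (A B : Matrix n n ℂ) : Matrix n n ℂ :=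
  A ^ (1 / 2 : ℝ) * (A ^ (-(1 / 2) : ℝ) * B * A ^ (-(1 / 2) : ℝ)) ^ t * A ^ (1 / 2 : ℝ)

/-- The weighted geometric mean `A #_t B` of positive semidefinite matrices, in the sense of Kubo
and Ando: the limit of `(A + ε) #_t (B + ε)` as `ε` decreases to `0`. (For `0 ≤ t ≤ 1` these are
positive semidefinite and decrease as `ε` decreases, so the limit exists.) -/
def geomMean (t : ℝ) (A B : Matrix n n ℂ) : Matrix n n ℂ :=
  Filter.limUnder (𝓝[>] (0 : ℝ)) fun ε => geomMeanPD t (A + ε • 1) (B + ε • 1)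

/-- The feasible set of the program that defines `D^#_α`:
`A ≥ 0` with `J ≤ K #_{1/α} A`. -/
def feasible (α : ℝ) (J K : Matrix n n ℂ) : Set (Matrix n n ℂ) :=
  {A | A.PosSemidef ∧ J ≤ geomMean (1 / α) K A}

/-- The support of an operator: the orthogonal complement of its kernel. -/
def supp (A : Matrix n n ℂ) : Submodule ℂ (EuclideanSpace ℂ n) :=
  (LinearMap.ker (Matrix.toEuclideanLin A))ᗮ

/-- The algebra `End^G` of operators that commute with a representation `τ` of `G` (a monoid
homomorphism from a group to matrices takes invertible values). -/
def endAlg (τ : G →* Matrix n n ℂ) : Subalgebra ℂ (Matrix n n ℂ) :=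
  Subalgebra.centralizer ℂ (Set.range τ)

/-- The tensor product of two representations. -/
def tensorRep (ρ : G →* Matrix X X ℂ) (τ : G →* Matrix Y Y ℂ) :
    G →* Matrix (X × Y) (X × Y) ℂ where
  toFun g := ρ g ⊗ₖ τ g
  map_one' := by simp
  map_mul' g h := by simp [Matrix.mul_kronecker_mul]

/-- The permutation matrix of `π` on `X^{⊗k}`, sending
`h_1 ⊗ ⋯ ⊗ h_k` to `h_{π⁻¹ 1} ⊗ ⋯ ⊗ h_{π⁻¹ k}`. -/
def permMat (X : Type*) [DecidableEq X] {k : ℕ} (π : Equiv.Perm (Fin k)) :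
    Matrix (Fin k → X) (Fin k → X) ℂ :=
  Matrix.of fun x x' => if x = x' ∘ π.symm then 1 else 0

theorem piKron_mul {k : ℕ} (R S : Fin k → Matrix X X ℂ) :
    piKron R * piKron S = piKron fun i => R i * S i := by
  ext x y
  simp only [piKron, Matrix.mul_apply, Matrix.of_apply, Finset.prod_univ_sum,
    Fintype.piFinset_univ, ← Finset.prod_mul_distrib]

theorem piKron_one {k : ℕ} : piKron (fun _ : Fin k => (1 : Matrix X X ℂ)) = 1 := by
  ext x y
  by_cases h : x = y
  · subst h; simp [piKron]
  · obtain ⟨i, hi⟩ := Function.ne_iff.mp h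
    rw [Matrix.one_apply_ne h, piKron, Matrix.of_apply]
    exact Finset.prod_eq_zero (Finset.mem_univ i) (Matrix.one_apply_ne hi)

theorem permMat_apply {k : ℕ} (π : Equiv.Perm (Fin k)) (x y : Fin k → X) :
    permMat X π x y = if x ∘ π = y then 1 else 0 := by
  simp only [permMat, Matrix.of_apply]
  congr 1
  rw [eq_iff_iff]
  exact Equiv.eq_comp_symm π x y

theorem permMat_mul {k : ℕ} (π π' : Equiv.Perm (Fin k)) :
    permMat X π * permMat X π' = permMat X (π * π') := by
  ext x y
  rw [Matrix.mul_apply, Finset.sum_eq_single (x ∘ π)]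
  · rw [permMat_apply, permMat_apply, permMat_apply, if_pos rfl, one_mul]
    rfl
  · intro z _ hz
    simp [permMat_apply, hz.symm]
  · simp

theorem permMat_mul_piKron {k : ℕ} (π : Equiv.Perm (Fin k)) (R : Fin k → Matrix X X ℂ) :
    permMat X π * piKron R = (piKron fun i => R (π.symm i)) * permMat X π := by
  ext x y
  rw [Matrix.mul_apply, Matrix.mul_apply, Finset.sum_eq_single (x ∘ π),
    Finset.sum_eq_single (y ∘ π.symm)]
  · have h : (y ∘ π.symm) ∘ π = y := by ext i; simp
    rw [permMat_apply, permMat_apply, if_pos rfl, if_pos h, one_mul, mul_one]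
    simp only [piKron, Matrix.of_apply, Function.comp_apply]
    rw [← Equiv.prod_comp π (fun i => R (π.symm i) (x i) (y (π.symm i)))]
    simp
  · intro z _ hz
    simp [permMat, hz]
  · simp
  · intro z _ hz
    simp [permMat_apply, hz.symm]
  · simp

/-- The group `G^k ⋊ S_k`, in which
`(g', π') * (g, π) = (g' * (g_{π'⁻¹ 1}, …, g_{π'⁻¹ k}), π' π)`. -/
abbrev WreathGroup (G : Type*) [Group G] (k : ℕ) : Type _ :=
  (Fin k → G) ⋊[(mulAutArrow : Equiv.Perm (Fin k) →* MulAut (Fin k → G))] Equiv.Perm (Fin k)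

/-- The representation of `G^k ⋊ S_k` on `X^{⊗k}` induced by a representation `ρ` of `G` on `X`:
`(g, π)` acts as `(ρ g_1 ⊗ ⋯ ⊗ ρ g_k) P(π)`. -/
def wreathRep (k : ℕ) (ρ : G →* Matrix X X ℂ) :
    WreathGroup G k →* Matrix (Fin k → X) (Fin k → X) ℂ where
  toFun h := piKron (fun i => ρ (h.left i)) * permMat X h.right
  map_one' := by
    have h : permMat X (1 : Equiv.Perm (Fin k)) = 1 := by
      ext x y
      simp [permMat_apply, Matrix.one_apply]
    simp [piKron_one, h]
  map_mul' h₁ h₂ := by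
    rw [mul_assoc, ← mul_assoc (permMat X h₁.right), permMat_mul_piKron, mul_assoc, permMat_mul,
      ← mul_assoc, piKron_mul]
    simp only [SemidirectProduct.mul_left, SemidirectProduct.mul_right, Pi.mul_apply, map_mul]
    rfl

end SharpDivergence

end
open SharpDivergence

noncomputable section

namespace SharpDivergence

set_option linter.unusedSectionVars false

variable {n X Y G : Type*} [Fintype n] [DecidableEq n] [Fintype X] [DecidableEq X]
  [Fintype Y] [DecidableEq Y] [Group G]

/-! ### Weighted geometric means -/

/-! Write J and K for the Choi matrices of the k-th tensor powers of N and M. The representations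
need not be unitary, so averaging an optimizer over conjugations by the group could destroy
positivity. Instead, one canonical optimizer is chosen and shown to commute with every invertible
product operator S ⊗ T that commutes with J and K.

The feasible set is closed, stable under midpoints (operator concavity of the mean) and stable under
conjugation by unitaries that commute with J and K. The objective is convex, invariant under local
unitaries U ⊗ V, and has compact sublevel sets in the feasible set. The support inclusion gives J ≤
cK for some c, hence a feasible point, so optimizers exist. Among them take A of least
Hilbert-Schmidt norm. By strict convexity it is unique, so it commutes with each U ⊗ V commuting
with J and K (`exists_optimal_commute_kronecker_unitary`).

For a general S ⊗ T, self-adjointness of J and K makes the adjoint commute with them too. Hence so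
does L = log |S ⊗ T|², which has the form a ⊗ 1 + 1 ⊗ b. Both exp(isL) and the unitary polar factor
are then local unitaries commuting with J and K, so they commute with A. Differentiating in s shows
that L commutes with A, and therefore so does S ⊗ T (`commute_kronecker_of_commute_unitary`). -/

theorem rpow_unitary_conj {u A : Matrix n n ℂ} (hu : u ∈ unitary (Matrix n n ℂ)) (hA : 0 ≤ A)
    (r : ℝ) : (u * A * star u) ^ r = u * A ^ r * star u := by
  have hA' : 0 ≤ u * A * star u := star_right_conjugate_nonneg hA u
  rw [CFC.rpow_eq_cfc_real hA, CFC.rpow_eq_cfc_real hA']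
  have h := StarAlgHomClass.map_cfc (R := ℝ) (S := ℂ) (Unitary.conjStarAlgAut ℂ _ ⟨u, hu⟩)
    (fun x : ℝ => x ^ r) A (hf := (Matrix.finite_real_spectrum (A := A)).continuousOn _)
    (hφ := by
      have : Continuous fun x : Matrix n n ℂ => u * x * star u := by fun_prop
      exact this)
    (ha := hA.isSelfAdjoint) (hφa := hA'.isSelfAdjoint)
  exact h.symm

theorem geomMeanPD_unitary_conj {u A B : Matrix n n ℂ} (hu : u ∈ unitary (Matrix n n ℂ))
    (hA : 0 ≤ A) (hB : 0 ≤ B) (t : ℝ) :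
    geomMeanPD t (u * A * star u) (u * B * star u) = u * geomMeanPD t A B * star u := by
  have hu' : star u * u = 1 := hu.1
  have hc : ∀ x y : Matrix n n ℂ, u * x * star u * (u * y * star u) = u * (x * y) * star u := by
    intro x y
    calc u * x * star u * (u * y * star u) = u * x * (star u * u) * y * star u := by
          noncomm_ring
      _ = _ := by rw [hu']; noncomm_ring
  have h0 : 0 ≤ A ^ (-(1 / 2) : ℝ) * B * A ^ (-(1 / 2) : ℝ) :=
    conjugate_nonneg_of_nonneg hB CFC.rpow_nonneg
  simp only [geomMeanPD, rpow_unitary_conj hu hA, hc, rpow_unitary_conj hu h0]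

theorem geomMeanPD_mono_right {t : ℝ} (ht : t ∈ Set.Icc (0 : ℝ) 1) {A B B' : Matrix n n ℂ}
    (h : B ≤ B') : geomMeanPD t A B ≤ geomMeanPD t A B' :=
  conjugate_le_conjugate_of_nonneg
    (CFC.rpow_le_rpow ht (conjugate_le_conjugate_of_nonneg h CFC.rpow_nonneg)) CFC.rpow_nonneg

theorem geomMeanPD_nonneg (t : ℝ) (A B : Matrix n n ℂ) : 0 ≤ geomMeanPD t A B :=
  conjugate_nonneg_of_nonneg CFC.rpow_nonneg CFC.rpow_nonneg

/-- Operator concavity of x ↦ x^t on [0, 1], transported by the congruences with A^{∓1/2}. -/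
theorem geomMeanPD_midpoint_le {t : ℝ} (ht : t ∈ Set.Icc (0 : ℝ) 1) {A B B' : Matrix n n ℂ}
    (hB : 0 ≤ B) (hB' : 0 ≤ B') :
    (1 / 2 : ℝ) • geomMeanPD t A B + (1 / 2 : ℝ) • geomMeanPD t A B' ≤
      geomMeanPD t A ((1 / 2 : ℝ) • B + (1 / 2 : ℝ) • B') := by
  have h := (CFC.concaveOn_rpow (A := Matrix n n ℂ) ht).2
    (conjugate_nonneg_of_nonneg hB (CFC.rpow_nonneg (a := A) (y := -(1 / 2))))
    (conjugate_nonneg_of_nonneg hB' (CFC.rpow_nonneg (a := A) (y := -(1 / 2))))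
    (by norm_num : (0 : ℝ) ≤ 1 / 2) (by norm_num : (0 : ℝ) ≤ 1 / 2) (by norm_num)
  have h' := conjugate_le_conjugate_of_nonneg h (CFC.rpow_nonneg (a := A) (y := 1 / 2))
  simpa only [geomMeanPD, mul_add, add_mul, mul_smul_comm, smul_mul_assoc] using h'

theorem rpow_half_mul_self {A : Matrix n n ℂ} (hA : 0 ≤ A) :
    A ^ (1 / 2 : ℝ) * A ^ (1 / 2 : ℝ) = A := by
  rw [← CFC.sqrt_eq_rpow, CFC.sqrt_mul_sqrt_self A hA]

theorem geomMeanPD_smul_self {A : Matrix n n ℂ} (hA : IsStrictlyPositive A) (t : ℝ) {c : ℝ}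
    (hc : 0 ≤ c) : geomMeanPD t A (c • A) = c ^ t • A := by
  have h1 : A ^ (-(1 / 2) : ℝ) * (c • A) * A ^ (-(1 / 2) : ℝ) = c • 1 := by
    rw [mul_smul_comm, smul_mul_assoc]
    congr 1
    nth_rw 2 [← rpow_half_mul_self hA.nonneg]
    rw [← mul_assoc, CFC.rpow_neg_mul_rpow _ hA, one_mul, CFC.rpow_mul_rpow_neg _ hA]
  have h2 : (c • (1 : Matrix n n ℂ)) ^ t = c ^ t • 1 := by
    lift c to NNReal using hc
    have := CFC.rpow_algebraMap (A := Matrix n n ℂ) (x := c) (y := t)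
    rw [Algebra.algebraMap_eq_smul_one, Algebra.algebraMap_eq_smul_one] at this
    exact this
  rw [geomMeanPD, h1, h2, mul_smul_comm, mul_one, smul_mul_assoc, rpow_half_mul_self hA.nonneg]

/-- The geometric mean is symmetric: `A #_t B = B #_{1-t} A`. -/
theorem geomMeanPD_symm {A B : Matrix n n ℂ} (hA : IsStrictlyPositive A)
    (hB : IsStrictlyPositive B) (t : ℝ) : geomMeanPD t A B = geomMeanPD (1 - t) B A := by
  set a := A ^ (1 / 2 : ℝ) with ha
  set a' := A ^ (-(1 / 2) : ℝ) with ha'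
  set b := B ^ (1 / 2 : ℝ) with hb
  set b' := B ^ (-(1 / 2) : ℝ) with hb'
  have aa : a * a = A := rpow_half_mul_self hA.nonneg
  have bb : b * b = B := rpow_half_mul_self hB.nonneg
  have aa' : a * a' = 1 := CFC.rpow_mul_rpow_neg _ hA
  have a'a : a' * a = 1 := CFC.rpow_neg_mul_rpow _ hA
  have bb' : b * b' = 1 := CFC.rpow_mul_rpow_neg _ hB
  have b'b : b' * b = 1 := CFC.rpow_neg_mul_rpow _ hB
  have sa : star a = a := (CFC.rpow_nonneg (a := A)).isSelfAdjoint
  have sb' : star b' = b' := (CFC.rpow_nonneg (a := B)).isSelfAdjoint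
  set F := b' * A * b' with hF
  have F0 : 0 ≤ F := conjugate_nonneg_of_nonneg hA.nonneg CFC.rpow_nonneg
  have Fu : IsUnit F :=
    ((IsUnit.of_mul_eq_one _ b'b).mul hA.isUnit).mul (IsUnit.of_mul_eq_one _ b'b)
  have FP : IsStrictlyPositive F := Fu.isStrictlyPositive F0
  set f := F ^ (-(1 / 2) : ℝ) with hf
  have sf : star f = f := (CFC.rpow_nonneg (a := F)).isSelfAdjoint
  set g := F ^ (1 / 2 : ℝ) with hg
  have gg : g * g = F := rpow_half_mul_self F0
  have fg : f * g = 1 := CFC.rpow_neg_mul_rpow _ FP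
  have gf : g * f = 1 := CFC.rpow_mul_rpow_neg _ FP
  have hFG : F = b' * a * (a * b') := by rw [hF, ← aa]; noncomm_ring
  -- With Z = B^{-1/2} A^{1/2} one has F = Z Z*, and U = F^{-1/2} Z is the unitary polar factor of
  -- Z. Thus A^{-1/2} B A^{-1/2} = (Z* Z)⁻¹ = U* F⁻¹ U, which turns the t-th power into a power of
  -- F.
  set U := f * (b' * a) with hU
  have sU : star U = a * b' * f := by rw [hU]; simp [sa, sb', sf]
  have UU : U * star U = 1 := by
    calc U * star U = f * (b' * a * (a * b')) * f := by rw [sU, hU]; simp only [mul_assoc]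
      _ = (f * g) * (g * f) := by rw [← hFG, ← gg]; noncomm_ring
      _ = 1 := by rw [fg, gf, one_mul]
  have UU' : star U * U = 1 := mul_eq_one_comm.mp UU
  have hUm : star U ∈ unitary (Matrix n n ℂ) := by
    rw [Unitary.mem_iff, star_star]; exact ⟨UU, UU'⟩
  have hff : F ^ (-1 : ℝ) = f * f := by
    rw [hf, ← CFC.rpow_add Fu]; norm_num
  have h1 : f * f * (b' * a) = b * a' := by
    have e : f * f * F = 1 := by
      calc f * f * F = f * (f * g) * g := by rw [← gg]; noncomm_ring
        _ = 1 := by rw [fg, mul_one, fg]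
    calc f * f * (b' * a) = f * f * (b' * a) * (a * (b' * b) * a') := by
          rw [b'b, mul_one, aa', mul_one]
      _ = f * f * (b' * a * (a * b')) * (b * a') := by noncomm_ring
      _ = b * a' := by rw [← hFG, e, one_mul]
  have h2 : a * b' * (f * f) = a' * b := by
    have e : F * (f * f) = 1 := by
      calc F * (f * f) = g * (g * f) * f := by rw [← gg]; noncomm_ring
        _ = 1 := by rw [gf, mul_one, gf]
    calc a * b' * (f * f) = (a' * (b * b') * a) * (a * b' * (f * f)) := by
          rw [bb', mul_one, a'a, one_mul]
      _ = a' * b * ((b' * a * (a * b')) * (f * f)) := by noncomm_ring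
      _ = a' * b := by rw [← hFG, e, mul_one]
  have hD : a' * B * a' = star U * F ^ (-1 : ℝ) * star (star U) := by
    rw [star_star, sU, hff]
    calc a' * B * a' = (a' * b) * (b * a') := by rw [← bb]; noncomm_ring
      _ = a * b' * (f * f) * (f * f * (b' * a)) := by rw [h1, h2]
      _ = _ := by rw [hU]; noncomm_ring
  have hDt : (a' * B * a') ^ t = star U * F ^ (-t) * U := by
    rw [hD, rpow_unitary_conj hUm CFC.rpow_nonneg, star_star,
      CFC.rpow_rpow F (-1) t (by norm_num) FP, neg_one_mul]
  have haU : a * star U = b * g := by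
    calc a * star U = b * b' * a * (a * b' * f) := by rw [sU, bb', one_mul]
      _ = b * (b' * a * (a * b')) * f := by noncomm_ring
      _ = b * g * (g * f) := by rw [← hFG, ← gg]; noncomm_ring
      _ = b * g := by rw [gf, mul_one]
  have hUa : U * a = g * b := by
    calc U * a = f * (b' * a) * (a * (b' * b)) := by rw [hU, b'b, mul_one]
      _ = f * (b' * a * (a * b')) * b := by noncomm_ring
      _ = (f * g) * g * b := by rw [← hFG, ← gg]; noncomm_ring
      _ = g * b := by rw [fg, one_mul]
  calc geomMeanPD t A B = a * (a' * B * a') ^ t * a := rfl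
    _ = (a * star U) * F ^ (-t) * (U * a) := by rw [hDt]; noncomm_ring
    _ = b * (g * F ^ (-t) * g) * b := by rw [haU, hUa]; noncomm_ring
    _ = b * F ^ (1 - t) * b := by
      rw [hg, ← CFC.rpow_add Fu, ← CFC.rpow_add Fu]
      congr 3
      ring
    _ = geomMeanPD (1 - t) B A := rfl

/-- Monotonicity in the second argument is operator monotonicity of x^t; the symmetry
`geomMeanPD_symm` transfers it to the first. -/
theorem geomMeanPD_mono {t : ℝ} (ht : t ∈ Set.Icc (0 : ℝ) 1) {A A' B B' : Matrix n n ℂ}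
    (hA : IsStrictlyPositive A) (hB : IsStrictlyPositive B) (hAA : A ≤ A') (hBB : B ≤ B') :
    geomMeanPD t A B ≤ geomMeanPD t A' B' := by
  have hA' : IsStrictlyPositive A' := hA.of_le hAA
  have ht' : 1 - t ∈ Set.Icc (0 : ℝ) 1 := ⟨by linarith [ht.2], by linarith [ht.1]⟩
  calc geomMeanPD t A B = geomMeanPD (1 - t) B A := geomMeanPD_symm hA hB t
    _ ≤ geomMeanPD (1 - t) B A' := geomMeanPD_mono_right ht' hAA
    _ = geomMeanPD t A' B := (geomMeanPD_symm hA' hB t).symm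
    _ ≤ _ := geomMeanPD_mono_right ht hBB

theorem add_smul_one_isStrictlyPositive {A : Matrix n n ℂ} (hA : 0 ≤ A) {ε : ℝ} (hε : 0 < ε) :
    IsStrictlyPositive (A + ε • 1) := by
  have h : IsStrictlyPositive (ε • (1 : Matrix n n ℂ)) :=
    IsStrictlyPositive.smul hε isStrictlyPositive_one
  exact h.of_le (le_add_of_nonneg_left hA)

theorem geomMeanPD_add_smul_one_mono {t : ℝ} (ht : t ∈ Set.Icc (0 : ℝ) 1) {A B : Matrix n n ℂ}
    (hA : 0 ≤ A) (hB : 0 ≤ B) {ε δ : ℝ} (hε : 0 < ε) (h : ε ≤ δ) :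
    geomMeanPD t (A + ε • 1) (B + ε • 1) ≤ geomMeanPD t (A + δ • 1) (B + δ • 1) := by
  have h1 : ε • (1 : Matrix n n ℂ) ≤ δ • 1 := smul_le_smul_of_nonneg_right h zero_le_one
  exact geomMeanPD_mono ht (add_smul_one_isStrictlyPositive hA hε)
    (add_smul_one_isStrictlyPositive hB hε) (by gcongr) (by gcongr)

theorem isCompact_Icc_matrix (A B : Matrix n n ℂ) : IsCompact (Set.Icc A B) := by
  refine Metric.isCompact_of_isClosed_isBounded isClosed_Icc ?_
  refine (Metric.isBounded_closedBall (x := A) (r := ‖B - A‖)).subset fun C hC => ?_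
  rw [mem_closedBall_iff_norm]
  exact CStarAlgebra.norm_le_norm_of_nonneg_of_le (sub_nonneg.mpr hC.1) (sub_le_sub_right hC.2 A)

/-- The regularized means decrease with ε inside a compact order interval, so they converge. This is
what rules out the junk value of `limUnder` in `geomMean`. -/
theorem tendsto_geomMean {t : ℝ} (ht : t ∈ Set.Icc (0 : ℝ) 1) {A B : Matrix n n ℂ}
    (hA : 0 ≤ A) (hB : 0 ≤ B) :
    Filter.Tendsto (fun ε : ℝ => geomMeanPD t (A + ε • 1) (B + ε • 1)) (𝓝[>] 0)
      (𝓝 (geomMean t A B)) := by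
  refine tendsto_nhds_limUnder ?_
  set f := fun ε : ℝ => geomMeanPD t (A + ε • 1) (B + ε • 1) with hf
  have hmem : ∀ᶠ ε in 𝓝[>] (0 : ℝ), f ε ∈ Set.Icc 0 (f 1) := by
    filter_upwards [Ioc_mem_nhdsGT zero_lt_one] with ε hε
    exact ⟨geomMeanPD_nonneg _ _ _, geomMeanPD_add_smul_one_mono ht hA hB hε.1 hε.2⟩
  have hK := isCompact_Icc_matrix 0 (f 1)
  have key : ∀ L L', MapClusterPt L (𝓝[>] (0 : ℝ)) f → MapClusterPt L' (𝓝[>] (0 : ℝ)) f →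
      L ≤ L' := by
    intro L L' hL hL'
    -- A cluster point lies below every f δ, hence below every other cluster point; antisymmetry
    -- then gives uniqueness.
    have h1 : ∀ δ > 0, L ≤ f δ := fun δ hδ => by
      refine isClosed_Iic.closure_subset
        (mem_closure_iff_clusterPt.mpr (hL.clusterPt.mono ?_))
      rw [Filter.le_principal_iff, Filter.mem_map]
      filter_upwards [Ioc_mem_nhdsGT hδ] with ε hε
      exact geomMeanPD_add_smul_one_mono ht hA hB hε.1 hε.2
    refine isClosed_Ici.closure_subset (mem_closure_iff_clusterPt.mpr (hL'.clusterPt.mono ?_))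
    rw [Filter.le_principal_iff, Filter.mem_map]
    filter_upwards [self_mem_nhdsWithin] with δ hδ
    exact h1 δ hδ
  obtain ⟨L, -, hL⟩ := hK.exists_mapClusterPt (f := 𝓝[>] (0 : ℝ)) (u := f)
    (Filter.tendsto_principal.mpr hmem)
  exact ⟨L, hK.tendsto_nhds_of_unique_mapClusterPt hmem fun L' _ hL' =>
    le_antisymm (key _ _ hL' hL) (key _ _ hL hL')⟩

/-- The mean is the infimum of its regularizations, so feasibility becomes a family of inequalities
between positive definite means, with no limit left to handle. -/
theorem le_geomMean_iff {t : ℝ} (ht : t ∈ Set.Icc (0 : ℝ) 1) {A B J : Matrix n n ℂ}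
    (hA : 0 ≤ A) (hB : 0 ≤ B) :
    J ≤ geomMean t A B ↔ ∀ ε : ℝ, 0 < ε → J ≤ geomMeanPD t (A + ε • 1) (B + ε • 1) := by
  have hlim := tendsto_geomMean ht hA hB
  constructor
  · intro h ε hε
    refine h.trans (le_of_tendsto hlim ?_)
    filter_upwards [Ioc_mem_nhdsGT hε] with δ hδ
    exact geomMeanPD_add_smul_one_mono ht hA hB hδ.1 hδ.2
  · intro h
    refine ge_of_tendsto hlim ?_
    filter_upwards [self_mem_nhdsWithin] with δ hδ
    exact h δ hδ

/-! ### The feasible set -/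

theorem one_div_mem_Icc {α : ℝ} (hα : 1 < α) : 1 / α ∈ Set.Icc (0 : ℝ) 1 :=
  ⟨by positivity, by rw [div_le_one (by linarith)]; exact hα.le⟩

theorem mem_feasible_iff {α : ℝ} (hα : 1 < α) {J K : Matrix n n ℂ} (hK : 0 ≤ K)
    {A : Matrix n n ℂ} : A ∈ feasible α J K ↔
      0 ≤ A ∧ ∀ ε : ℝ, 0 < ε → J ≤ geomMeanPD (1 / α) (K + ε • 1) (A + ε • 1) := by
  rw [feasible, Set.mem_ofPred_eq, ← Matrix.nonneg_iff_posSemidef]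
  exact and_congr_right fun hA => le_geomMean_iff (one_div_mem_Icc hα) hK hA

theorem feasible_nonempty {α : ℝ} (hα : 1 < α) {J K : Matrix n n ℂ} (hK : 0 ≤ K) {c : ℝ}
    (hc : 0 ≤ c) (h : J ≤ c • K) : (feasible α J K).Nonempty := by
  have hd : 0 ≤ c ^ α := Real.rpow_nonneg hc α
  have ht := one_div_mem_Icc hα
  have hA : 0 ≤ c ^ α • (K + 1) := smul_nonneg hd (add_nonneg hK zero_le_one)
  -- The factor comes from K #_{1/α} (c^α K) = cK. The extra 1 absorbs the regularization for ε ≤ 1;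
  -- larger ε follow by monotonicity.
  refine ⟨c ^ α • (K + 1), (mem_feasible_iff hα hK).mpr ⟨hA, ?_⟩⟩
  have small : ∀ ε : ℝ, 0 < ε → ε ≤ 1 →
      J ≤ geomMeanPD (1 / α) (K + ε • 1) (c ^ α • (K + 1) + ε • 1) := by
    intro ε hε hε1
    have hKε := add_smul_one_isStrictlyPositive hK hε
    have h1 : ε • (1 : Matrix n n ℂ) ≤ 1 := by
      simpa using smul_le_smul_of_nonneg_right hε1 (zero_le_one (α := Matrix n n ℂ))
    have h0 : 0 ≤ ε • (1 : Matrix n n ℂ) := smul_nonneg hε.le zero_le_one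
    have h2 : c ^ α • (K + ε • 1) ≤ c ^ α • (K + 1) + ε • 1 :=
      (smul_le_smul_of_nonneg_left (add_le_add_right h1 K) hd).trans (le_add_of_nonneg_right h0)
    calc J ≤ c • K := h
      _ ≤ c • (K + ε • 1) := smul_le_smul_of_nonneg_left (le_add_of_nonneg_right h0) hc
      _ = geomMeanPD (1 / α) (K + ε • 1) (c ^ α • (K + ε • 1)) := by
        rw [geomMeanPD_smul_self hKε _ hd, ← Real.rpow_mul hc, mul_one_div_cancel (by linarith),
          Real.rpow_one]
      _ ≤ _ := geomMeanPD_mono_right ht h2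
  intro ε hε
  refine (small (min ε 1) (by positivity) (min_le_right _ _)).trans ?_
  exact geomMeanPD_add_smul_one_mono ht hK hA (by positivity) (min_le_left _ _)

/-- Continuity of the mean is not needed: if B is feasible within ε/2 of A, then B + ε/2 ≤ A + ε,
and monotonicity moves the constraint from B at ε/2 to A at ε. -/
theorem isClosed_feasible {α : ℝ} (hα : 1 < α) {J K : Matrix n n ℂ} (hK : 0 ≤ K) :
    IsClosed (feasible α J K) := by
  have ht := one_div_mem_Icc hα
  refine isClosed_of_closure_subset fun A hA => ?_
  have hA0 : 0 ≤ A := by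
    refine closure_minimal (fun B hB => ?_) isClosed_Ici hA
    exact ((mem_feasible_iff hα hK).mp hB).1
  refine (mem_feasible_iff hα hK).mpr ⟨hA0, fun ε hε => ?_⟩
  obtain ⟨B, hB, hAB⟩ := Metric.mem_closure_iff.mp hA (ε / 2) (half_pos hε)
  obtain ⟨hB0, hB⟩ := (mem_feasible_iff hα hK).mp hB
  have h1 : B ≤ A + (ε / 2) • 1 := by
    have h := (hB0.isSelfAdjoint.sub hA0.isSelfAdjoint).le_algebraMap_norm_self
    rw [Algebra.algebraMap_eq_smul_one] at h
    rw [← sub_le_iff_le_add']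
    refine h.trans (smul_le_smul_of_nonneg_right ?_ zero_le_one)
    rw [← dist_eq_norm, dist_comm]
    exact hAB.le
  refine (hB (ε / 2) (half_pos hε)).trans (geomMeanPD_mono ht
    (add_smul_one_isStrictlyPositive hK (half_pos hε))
    (add_smul_one_isStrictlyPositive hB0 (half_pos hε)) ?_ ?_)
  · exact add_le_add_right (smul_le_smul_of_nonneg_right (by linarith) zero_le_one) K
  · calc B + (ε / 2) • 1 ≤ A + (ε / 2) • 1 + (ε / 2) • 1 := by gcongr
      _ = A + ε • 1 := by rw [add_assoc, ← add_smul, add_halves]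

theorem feasible_midpoint {α : ℝ} (hα : 1 < α) {J K : Matrix n n ℂ} (hK : 0 ≤ K)
    {A B : Matrix n n ℂ} (hA : A ∈ feasible α J K) (hB : B ∈ feasible α J K) :
    (1 / 2 : ℝ) • A + (1 / 2 : ℝ) • B ∈ feasible α J K := by
  rw [mem_feasible_iff hα hK] at *
  have h2 : (0 : ℝ) ≤ 1 / 2 := by norm_num
  refine ⟨add_nonneg (smul_nonneg h2 hA.1) (smul_nonneg h2 hB.1), fun ε hε => ?_⟩
  have e : (1 / 2 : ℝ) • A + (1 / 2 : ℝ) • B + ε • 1 =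
      (1 / 2 : ℝ) • (A + ε • 1) + (1 / 2 : ℝ) • (B + ε • 1) := by module
  rw [e]
  refine le_trans ?_ (geomMeanPD_midpoint_le (one_div_mem_Icc hα)
    (add_smul_one_isStrictlyPositive hA.1 hε).nonneg
    (add_smul_one_isStrictlyPositive hB.1 hε).nonneg)
  calc J = (1 / 2 : ℝ) • J + (1 / 2 : ℝ) • J := by module
    _ ≤ _ := add_le_add (smul_le_smul_of_nonneg_left (hA.2 ε hε) h2)
      (smul_le_smul_of_nonneg_left (hB.2 ε hε) h2)

theorem conj_eq_self_of_commute {W A : Matrix n n ℂ} (hW : W ∈ unitary (Matrix n n ℂ))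
    (h : Commute W A) : W * A * star W = A := by
  rw [h.eq, mul_assoc, hW.2, mul_one]

theorem feasible_unitary_conj {α : ℝ} (hα : 1 < α) {J K : Matrix n n ℂ} (hK : 0 ≤ K)
    {A W : Matrix n n ℂ} (hW : W ∈ unitary (Matrix n n ℂ)) (hWJ : Commute W J)
    (hWK : Commute W K) (hA : A ∈ feasible α J K) : W * A * star W ∈ feasible α J K := by
  rw [mem_feasible_iff hα hK] at *
  refine ⟨star_right_conjugate_nonneg hA.1 W, fun ε hε => ?_⟩
  have e : W * A * star W + ε • 1 = W * (A + ε • 1) * star W := by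
    rw [mul_add, add_mul, mul_smul_comm, smul_mul_assoc, mul_one, hW.2]
  have eK : K + ε • 1 = W * (K + ε • 1) * star W := by
    rw [conj_eq_self_of_commute hW (hWK.add_right ((Commute.one_right W).smul_right ε))]
  rw [e, eK, geomMeanPD_unitary_conj hW (add_smul_one_isStrictlyPositive hK hε).nonneg
    (add_smul_one_isStrictlyPositive hA.1 hε).nonneg]
  calc J = W * J * star W := (conj_eq_self_of_commute hW hWJ).symm
    _ ≤ _ := star_right_conjugate_le_conjugate (hA.2 ε hε) W

/-! ### The partial trace -/

theorem traceY_add (A B : Matrix (X × Y) (X × Y) ℂ) :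
    traceY (A + B) = traceY A + traceY B := by
  ext; simp [traceY, Finset.sum_add_distrib]

theorem traceY_smul (c : ℝ) (A : Matrix (X × Y) (X × Y) ℂ) :
    traceY (c • A) = c • traceY A := by
  ext; simp [traceY, Finset.mul_sum]

theorem continuous_traceY :
    Continuous (traceY : Matrix (X × Y) (X × Y) ℂ → Matrix X X ℂ) := by
  let f : Matrix (X × Y) (X × Y) ℂ →ₗ[ℝ] Matrix X X ℂ :=
    { toFun := traceY, map_add' := traceY_add, map_smul' := traceY_smul }
  exact f.continuous_of_finiteDimensional

theorem trace_traceY (A : Matrix (X × Y) (X × Y) ℂ) : (traceY A).trace = A.trace := by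
  simp [traceY, Matrix.trace, Fintype.sum_prod_type]

theorem traceY_mul_kronecker_one (A : Matrix (X × Y) (X × Y) ℂ) (U : Matrix X X ℂ) :
    traceY (A * (U ⊗ₖ 1)) = traceY A * U := by
  ext x x'
  simp only [traceY, Matrix.of_apply, Matrix.mul_apply, Fintype.sum_prod_type,
    Matrix.kroneckerMap_apply, Matrix.one_apply, mul_ite, mul_one, mul_zero,
    Finset.sum_ite_eq', Finset.mem_univ, if_true, Finset.sum_mul]
  exact Finset.sum_comm

theorem traceY_kronecker_one_mul (A : Matrix (X × Y) (X × Y) ℂ) (U : Matrix X X ℂ) :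
    traceY ((U ⊗ₖ 1) * A) = U * traceY A := by
  ext x x'
  simp only [traceY, Matrix.of_apply, Matrix.mul_apply, Fintype.sum_prod_type,
    Matrix.kroneckerMap_apply, Matrix.one_apply, mul_ite, ite_mul, zero_mul, mul_one, mul_zero,
    Finset.sum_ite_eq, Finset.mem_univ, if_true, Finset.mul_sum]
  exact Finset.sum_comm

theorem traceY_one_kronecker_mul_comm (A : Matrix (X × Y) (X × Y) ℂ) (V : Matrix Y Y ℂ) :
    traceY ((1 ⊗ₖ V) * A) = traceY (A * (1 ⊗ₖ V)) := by
  ext x x'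
  simp only [traceY, Matrix.of_apply, Matrix.mul_apply, Fintype.sum_prod_type_right,
    Matrix.kroneckerMap_apply, Matrix.one_apply, mul_ite, ite_mul, zero_mul, one_mul, mul_zero,
    Finset.sum_ite_eq, Finset.sum_ite_eq', Finset.mem_univ, if_true]
  rw [Finset.sum_comm]
  exact Finset.sum_congr rfl fun _ _ => Finset.sum_congr rfl fun _ _ => mul_comm _ _

/-- The partial trace is cyclic for operators acting on Y alone, so V cancels against its adjoint.
-/
theorem traceY_kronecker_conj (A : Matrix (X × Y) (X × Y) ℂ) (U : Matrix X X ℂ)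
    {V : Matrix Y Y ℂ} (hV : V ∈ unitary (Matrix Y Y ℂ)) :
    traceY ((U ⊗ₖ V) * A * star (U ⊗ₖ V)) = U * traceY A * star U := by
  have h1 : U ⊗ₖ V = (U ⊗ₖ 1) * (1 ⊗ₖ V) := by rw [← Matrix.mul_kronecker_mul, mul_one, one_mul]
  have h2 : star (U ⊗ₖ V) = ((1 : Matrix X X ℂ) ⊗ₖ star V) * (star U ⊗ₖ (1 : Matrix Y Y ℂ)) := by
    rw [← Matrix.mul_kronecker_mul, mul_one, one_mul]
    exact Matrix.conjTranspose_kronecker U V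
  have h3 : ((1 : Matrix X X ℂ) ⊗ₖ star V) * ((1 : Matrix X X ℂ) ⊗ₖ V) = 1 := by
    rw [← Matrix.mul_kronecker_mul, mul_one, hV.1, Matrix.one_kronecker_one]
  calc traceY ((U ⊗ₖ V) * A * star (U ⊗ₖ V))
      = traceY ((U ⊗ₖ 1) * ((1 ⊗ₖ V) * (A * (1 ⊗ₖ star V))) * (star U ⊗ₖ 1)) := by
        rw [h2, h1]; simp only [mul_assoc]
    _ = U * traceY (A * (((1 : Matrix X X ℂ) ⊗ₖ star V) * (1 ⊗ₖ V))) * star U := by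
        rw [traceY_mul_kronecker_one, traceY_kronecker_one_mul, traceY_one_kronecker_mul_comm,
          mul_assoc A]
    _ = _ := by rw [h3, mul_one]

theorem norm_unitary_conj {U : Matrix n n ℂ} (hU : U ∈ unitary (Matrix n n ℂ))
    (A : Matrix n n ℂ) : ‖U * A * star U‖ = ‖A‖ := by
  rw [CStarRing.norm_mul_mem_unitary _ (Unitary.star_mem hU), CStarRing.norm_mem_unitary_mul _ hU]

theorem isSelfAdjoint_traceY {A : Matrix (X × Y) (X × Y) ℂ} (hA : IsSelfAdjoint A) :
    IsSelfAdjoint (traceY A) := by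
  ext x x'
  simp only [Matrix.star_apply, traceY, Matrix.of_apply, star_sum]
  exact Finset.sum_congr rfl fun y _ => congrFun₂ hA.star_eq (x, y) (x', y)

theorem re_trace_le_card_mul_norm {A : Matrix n n ℂ} (hA : IsSelfAdjoint A) :
    A.trace.re ≤ Fintype.card n * ‖A‖ := by
  have h := (Matrix.le_iff.mp hA.le_algebraMap_norm_self).trace_nonneg
  rw [Algebra.algebraMap_eq_smul_one, Matrix.trace_sub, Matrix.trace_smul, Matrix.trace_one] at h
  have := (Complex.le_def.mp h).1
  simp at this
  linarith

theorem le_trace_smul_one {A : Matrix n n ℂ} (hA : 0 ≤ A) : A ≤ A.trace.re • 1 := by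
  rw [← Algebra.algebraMap_eq_smul_one]
  refine le_algebraMap_of_spectrum_le (fun x hx => ?_) hA.isSelfAdjoint
  have hP := Matrix.nonneg_iff_posSemidef.mp hA
  rw [hP.1.spectrum_real_eq_range_eigenvalues] at hx
  obtain ⟨i, rfl⟩ := hx
  rw [hP.1.trace_eq_sum_eigenvalues]
  simp only [Complex.re_sum, Complex.coe_algebraMap, Complex.ofReal_re]
  exact Finset.single_le_sum (f := hP.1.eigenvalues) (fun j _ => hP.eigenvalues_nonneg j)
    (Finset.mem_univ i)

/-- Compactness of sublevel sets: A ≤ (tr A) 1, and tr A = tr (tr_Y A) is at most |X| times the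
objective. -/
theorem mem_Icc_of_norm_traceY_le {A : Matrix (X × Y) (X × Y) ℂ} (hA : 0 ≤ A) {m : ℝ}
    (h : ‖traceY A‖ ≤ m) :
    A ∈ Set.Icc (0 : Matrix (X × Y) (X × Y) ℂ) ((Fintype.card X * m) • 1) := by
  refine ⟨hA, (le_trace_smul_one hA).trans (smul_le_smul_of_nonneg_right ?_ zero_le_one)⟩
  rw [← trace_traceY]
  exact (re_trace_le_card_mul_norm (isSelfAdjoint_traceY hA.isSelfAdjoint)).trans (by gcongr)

/-! ### The minimizer of least Hilbert-Schmidt norm -/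

/-- The squared Hilbert-Schmidt norm. -/
def hsNormSq (A : Matrix n n ℂ) : ℝ := (star A * A).trace.re

theorem hsNormSq_unitary_conj {U : Matrix n n ℂ} (hU : U ∈ unitary (Matrix n n ℂ))
    (A : Matrix n n ℂ) : hsNormSq (U * A * star U) = hsNormSq A := by
  have h : star (U * A * star U) * (U * A * star U) = U * (star A * A) * star U := by
    calc _ = U * star A * (star U * U) * A * star U := by
          simp only [star_mul, star_star, mul_assoc]
      _ = _ := by rw [hU.1]; simp only [mul_assoc, one_mul]
  rw [hsNormSq, h, Matrix.trace_mul_comm, ← mul_assoc, hU.1, one_mul, hsNormSq]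

theorem hsNormSq_parallelogram (A B : Matrix n n ℂ) :
    hsNormSq ((1 / 2 : ℝ) • A + (1 / 2 : ℝ) • B) + 1 / 4 * hsNormSq (A - B) =
      1 / 2 * hsNormSq A + 1 / 2 * hsNormSq B := by
  simp only [hsNormSq, star_add, star_sub, star_smul, star_trivial, add_mul, mul_add, sub_mul,
    mul_sub, smul_mul_assoc, mul_smul_comm, Matrix.trace_add, Matrix.trace_sub,
    Matrix.trace_smul, Complex.add_re, Complex.sub_re, Complex.smul_re, smul_eq_mul]
  ring

theorem hsNormSq_nonneg (A : Matrix n n ℂ) : 0 ≤ hsNormSq A :=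
  (Complex.le_def.mp (Matrix.posSemidef_conjTranspose_mul_self A).trace_nonneg).1

theorem eq_zero_of_hsNormSq_eq_zero {A : Matrix n n ℂ} (h : hsNormSq A = 0) : A = 0 := by
  have h' := Complex.le_def.mp (Matrix.posSemidef_conjTranspose_mul_self A).trace_nonneg
  exact Matrix.trace_conjTranspose_mul_self_eq_zero_iff.mp (Complex.ext h h'.2.symm)

/-- Two successive minimizations on compact sets: first the objective, then the Hilbert-Schmidt norm
among optimizers. -/
theorem exists_optimal_commute_kronecker_unitary {α : ℝ} (hα : 1 < α)
    {J K : Matrix (X × Y) (X × Y) ℂ} (hK : 0 ≤ K) (hne : (feasible α J K).Nonempty) :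
    ∃ A ∈ feasible α J K, (∀ B ∈ feasible α J K, ‖traceY A‖ ≤ ‖traceY B‖) ∧
      ∀ U ∈ unitary (Matrix X X ℂ), ∀ V ∈ unitary (Matrix Y Y ℂ),
        Commute (U ⊗ₖ V) J → Commute (U ⊗ₖ V) K → Commute (U ⊗ₖ V) A := by
  have hcont : Continuous fun A : Matrix (X × Y) (X × Y) ℂ => ‖traceY A‖ :=
    continuous_traceY.norm
  have hcpt : ∀ m : ℝ, IsCompact (feasible α J K ∩ {A | ‖traceY A‖ ≤ m}) := fun m =>
    (isCompact_Icc_matrix _ _).of_isClosed_subset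
      ((isClosed_feasible hα hK).inter (isClosed_le hcont continuous_const))
      fun A hA => mem_Icc_of_norm_traceY_le ((mem_feasible_iff hα hK).mp hA.1).1 hA.2
  obtain ⟨A₀, hA₀⟩ := hne
  obtain ⟨A₁, hA₁, hmin⟩ := (hcpt ‖traceY A₀‖).exists_isMinOn ⟨A₀, hA₀, by simp⟩
    hcont.continuousOn
  have hopt : ∀ B ∈ feasible α J K, ‖traceY A₁‖ ≤ ‖traceY B‖ := fun B hB => by
    by_cases h : ‖traceY B‖ ≤ ‖traceY A₀‖
    · exact hmin ⟨hB, h⟩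
    · exact hA₁.2.trans (not_le.mp h).le
  have hcont' : Continuous (hsNormSq : Matrix (X × Y) (X × Y) ℂ → ℝ) :=
    Complex.continuous_re.comp (by fun_prop : Continuous fun A : Matrix (X × Y) (X × Y) ℂ =>
      (star A * A).trace)
  obtain ⟨A, hA, hAmin⟩ := (hcpt ‖traceY A₁‖).exists_isMinOn ⟨A₁, hA₁.1, by simp⟩
    hcont'.continuousOn
  refine ⟨A, hA.1, fun B hB => hA.2.trans (hopt B hB), fun U hU V hV hJ hKc => ?_⟩
  have hW : U ⊗ₖ V ∈ unitary (Matrix (X × Y) (X × Y) ℂ) := Matrix.kronecker_mem_unitary hU hV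
  set W := U ⊗ₖ V with hWdef
  set B := W * A * star W with hB
  have hBf : B ∈ feasible α J K := feasible_unitary_conj hα hK hW hJ hKc hA.1
  have hBn : ‖traceY B‖ ≤ ‖traceY A₁‖ := by
    rw [hB, hWdef, traceY_kronecker_conj A U hV, norm_unitary_conj hU]
    exact hA.2
  have hhalf : ‖(1 / 2 : ℝ)‖ = 1 / 2 := by norm_num
  -- The midpoint of A and its conjugate B is again optimal. Since A and B have equal
  -- Hilbert-Schmidt norm, the parallelogram law forces A = B.
  have hM : hsNormSq A ≤ hsNormSq ((1 / 2 : ℝ) • A + (1 / 2 : ℝ) • B) := by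
    refine hAmin ⟨feasible_midpoint hα hK hA.1 hBf, ?_⟩
    rw [Set.mem_ofPred_eq, traceY_add, traceY_smul, traceY_smul]
    refine (norm_add_le _ _).trans ?_
    rw [norm_smul, norm_smul, hhalf]
    have h1 : ‖traceY A‖ ≤ ‖traceY A₁‖ := hA.2
    linarith
  have hAB : A = B := by
    refine sub_eq_zero.mp (eq_zero_of_hsNormSq_eq_zero (le_antisymm ?_ (hsNormSq_nonneg _)))
    have h1 := hsNormSq_parallelogram A B
    have h2 : hsNormSq B = hsNormSq A := hsNormSq_unitary_conj hW A
    linarith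
  calc W * A = W * A * (star W * W) := by rw [hW.1, mul_one]
    _ = B * W := by rw [hB, mul_assoc _ (star W) W]
    _ = A * W := by rw [← hAB]

/-! ### Commuting with a product of invertible operators -/

open NormedSpace (exp)

/-- Differentiate the commutation relation at s = 0. -/
theorem commute_of_commute_exp_smul_I {L A : Matrix n n ℂ}
    (h : ∀ s : ℝ, Commute (exp ((s * Complex.I) • L)) A) : Commute L A := by
  have hI : Commute (Complex.I • L) A := by
    have hd : HasDerivAt (fun s : ℝ => exp (s • (Complex.I • L)))
        (exp ((0 : ℝ) • (Complex.I • L)) * (Complex.I • L)) 0 :=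
      hasDerivAt_exp_smul_const (𝕂 := ℝ) (Complex.I • L) 0
    rw [zero_smul, NormedSpace.exp_zero, one_mul] at hd
    have h1 := hd.mul_const A
    have h2 := hd.const_mul A
    have e : (fun s : ℝ => exp (s • (Complex.I • L)) * A) =
        fun s : ℝ => A * exp (s • (Complex.I • L)) := by
      ext1 s
      have := (h s).eq
      rwa [mul_smul, Complex.coe_smul] at this
    rw [e] at h1
    exact h1.unique h2
  have := hI.smul_left (-Complex.I)
  rwa [smul_smul, neg_mul, Complex.I_mul_I, neg_neg, one_smul] at this

theorem exp_kronecker_one (a : Matrix X X ℂ) :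
    exp (a ⊗ₖ (1 : Matrix Y Y ℂ)) = exp a ⊗ₖ (1 : Matrix Y Y ℂ) := by
  let f : Matrix X X ℂ →+* Matrix (X × Y) (X × Y) ℂ :=
    { toFun := fun a => a ⊗ₖ (1 : Matrix Y Y ℂ)
      map_one' := Matrix.one_kronecker_one
      map_mul' := fun a b => by rw [← Matrix.mul_kronecker_mul, mul_one]
      map_zero' := Matrix.zero_kronecker _
      map_add' := fun a b => Matrix.add_kronecker _ _ _ }
  have hf : Continuous f := by
    refine continuous_matrix fun i j => ?_
    simp only [f, RingHom.coe_mk, MonoidHom.coe_mk, OneHom.coe_mk, Matrix.kroneckerMap_apply]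
    fun_prop
  exact (NormedSpace.map_exp_of_mem_ball (𝕂 := ℂ) f hf a
    (by simp [NormedSpace.expSeries_radius_eq_top])).symm

theorem exp_one_kronecker (b : Matrix Y Y ℂ) :
    exp ((1 : Matrix X X ℂ) ⊗ₖ b) = (1 : Matrix X X ℂ) ⊗ₖ exp b := by
  let f : Matrix Y Y ℂ →+* Matrix (X × Y) (X × Y) ℂ :=
    { toFun := fun a => (1 : Matrix X X ℂ) ⊗ₖ a
      map_one' := Matrix.one_kronecker_one
      map_mul' := fun a b => by rw [← Matrix.mul_kronecker_mul, mul_one]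
      map_zero' := Matrix.kronecker_zero _
      map_add' := fun a b => Matrix.kronecker_add _ _ _ }
  have hf : Continuous f := by
    refine continuous_matrix fun i j => ?_
    simp only [f, RingHom.coe_mk, MonoidHom.coe_mk, OneHom.coe_mk, Matrix.kroneckerMap_apply]
    fun_prop
  exact (NormedSpace.map_exp_of_mem_ball (𝕂 := ℂ) f hf b
    (by simp [NormedSpace.expSeries_radius_eq_top])).symm

/-- The generator `a ⊗ 1 + 1 ⊗ b` of the one-parameter group `exp (s a) ⊗ exp (s b)`. -/
def kronSum (a : Matrix X X ℂ) (b : Matrix Y Y ℂ) : Matrix (X × Y) (X × Y) ℂ :=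
  a ⊗ₖ 1 + 1 ⊗ₖ b

theorem exp_smul_kronSum (c : ℂ) (a : Matrix X X ℂ) (b : Matrix Y Y ℂ) :
    exp (c • kronSum a b) = exp (c • a) ⊗ₖ exp (c • b) := by
  have hc : Commute ((c • a) ⊗ₖ (1 : Matrix Y Y ℂ)) ((1 : Matrix X X ℂ) ⊗ₖ (c • b)) := by
    simp only [Commute, SemiconjBy, ← Matrix.mul_kronecker_mul, mul_one, one_mul]
  rw [kronSum, smul_add, ← Matrix.smul_kronecker, ← Matrix.kronecker_smul,
    Matrix.exp_add_of_commute _ _ hc, exp_kronecker_one, exp_one_kronecker,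
    ← Matrix.mul_kronecker_mul, mul_one, one_mul]

theorem isSelfAdjoint_kronSum {a : Matrix X X ℂ} {b : Matrix Y Y ℂ} (ha : IsSelfAdjoint a)
    (hb : IsSelfAdjoint b) : IsSelfAdjoint (kronSum a b) := by
  have ha' : aᴴ = a := ha
  have hb' : bᴴ = b := hb
  rw [kronSum]
  refine IsSelfAdjoint.add ?_ ?_
  · rw [IsSelfAdjoint, Matrix.star_eq_conjTranspose, Matrix.conjTranspose_kronecker, ha',
      Matrix.conjTranspose_one]
  · rw [IsSelfAdjoint, Matrix.star_eq_conjTranspose, Matrix.conjTranspose_kronecker, hb',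
      Matrix.conjTranspose_one]

theorem exp_mul_I_smul_mem_unitary {a : Matrix n n ℂ} (ha : IsSelfAdjoint a) (s : ℝ) :
    exp ((s * Complex.I) • a) ∈ unitary (Matrix n n ℂ) := by
  have h : star ((s * Complex.I) • a) = -((s * Complex.I) • a) := by
    rw [star_smul, ha.star_eq]; simp
  have e := Matrix.exp_conjTranspose ((s * Complex.I) • a)
  rw [← Matrix.star_eq_conjTranspose, h] at e
  have h1 : exp (-((s * Complex.I) • a)) * exp ((s * Complex.I) • a) = 1 := by
    rw [← Matrix.exp_add_of_commute _ _ (Commute.refl ((s * Complex.I) • a)).neg_left, neg_add_cancel,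
      NormedSpace.exp_zero]
  rw [Unitary.mem_iff, Matrix.star_eq_conjTranspose, ← e]
  exact ⟨h1, mul_eq_one_comm.mp h1⟩

/-- The polar decomposition S = V exp(a/2), with a = log (S* S). -/
theorem exists_polar_exp {S : Matrix n n ℂ} (hS : IsUnit S) :
    ∃ a, IsSelfAdjoint a ∧ star S * S = exp a ∧
      S * exp ((-(1 / 2) : ℂ) • a) ∈ unitary (Matrix n n ℂ) := by
  have hP : IsStrictlyPositive (star S * S) :=
    (hS.star.mul hS).isStrictlyPositive (star_mul_self_nonneg S)
  set a := CFC.log (star S * S) with ha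
  have hsa : IsSelfAdjoint a := IsSelfAdjoint.log
  have hexp : exp a = star S * S := CFC.exp_log _ hP
  refine ⟨a, hsa, hexp.symm, ?_⟩
  set e := exp ((-(1 / 2) : ℂ) • a) with he
  have hse : star e = e := by
    have h := Matrix.exp_conjTranspose ((-(1 / 2) : ℂ) • a)
    rw [← Matrix.star_eq_conjTranspose, star_smul, hsa.star_eq] at h
    rw [he, Matrix.star_eq_conjTranspose, ← h]
    simp
  have hc : ∀ c d : ℂ, Commute (c • a) (d • a) := fun c d =>
    ((Commute.refl a).smul_left c).smul_right d
  have h1 : star (S * e) * (S * e) = 1 := by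
    calc star (S * e) * (S * e) = e * (star S * S) * e := by
          rw [star_mul, hse]; simp only [mul_assoc]
      _ = e * exp ((1 : ℂ) • a) * e := by rw [one_smul, hexp]
      _ = 1 := by
        rw [he, ← Matrix.exp_add_of_commute _ _ (hc _ _), ← add_smul,
          ← Matrix.exp_add_of_commute _ _ (hc _ _), ← add_smul]
        norm_num
  rw [Unitary.mem_iff]
  exact ⟨h1, mul_eq_one_comm.mp h1⟩

theorem commute_kronecker_of_commute_unitary {J K A : Matrix (X × Y) (X × Y) ℂ}
    (hJ : IsSelfAdjoint J) (hK : IsSelfAdjoint K)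
    (hA : ∀ U ∈ unitary (Matrix X X ℂ), ∀ V ∈ unitary (Matrix Y Y ℂ),
      Commute (U ⊗ₖ V) J → Commute (U ⊗ₖ V) K → Commute (U ⊗ₖ V) A)
    {S : Matrix X X ℂ} {T : Matrix Y Y ℂ} (hS : IsUnit S) (hT : IsUnit T)
    (hSJ : Commute (S ⊗ₖ T) J) (hSK : Commute (S ⊗ₖ T) K) : Commute (S ⊗ₖ T) A := by
  obtain ⟨a, ha, haS, hU⟩ := exists_polar_exp hS
  obtain ⟨b, hb, hbT, hV⟩ := exists_polar_exp hT
  have hL := isSelfAdjoint_kronSum ha hb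
  set L := kronSum a b with hLdef
  have hexp : exp L = star (S ⊗ₖ T) * (S ⊗ₖ T) := by
    have h := exp_smul_kronSum 1 a b
    rw [one_smul, one_smul, one_smul, ← haS, ← hbT] at h
    rw [hLdef, h, Matrix.mul_kronecker_mul, Matrix.star_eq_conjTranspose (S ⊗ₖ T),
      Matrix.conjTranspose_kronecker]
    rfl
  have hcomm : ∀ B : Matrix (X × Y) (X × Y) ℂ, IsSelfAdjoint B → Commute (S ⊗ₖ T) B →
      Commute L B := by
    intro B hB hSB
    have h1 : Commute (star (S ⊗ₖ T)) B := by
      have := hSB.star_star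
      rwa [hB.star_eq] at this
    have h2 : Commute (exp L) B := by rw [hexp]; exact h1.mul_left hSB
    -- B commutes with exp L, hence with its logarithm L, by functional calculus.
    rw [← CFC.log_exp L hL, CFC.log]
    exact h2.cfc_real Real.log
  have hcexp : ∀ (c : ℂ) {B : Matrix (X × Y) (X × Y) ℂ}, Commute L B → Commute (exp (c • L)) B :=
    fun c B h => (h.smul_left c).exp_left
  have hLJ := hcomm J hJ hSJ
  have hLK := hcomm K hK hSK
  have hLA : Commute L A := commute_of_commute_exp_smul_I fun s => by
    have h := hA _ (exp_mul_I_smul_mem_unitary ha s) _ (exp_mul_I_smul_mem_unitary hb s)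
    rw [← exp_smul_kronSum] at h
    exact h (hcexp _ hLJ) (hcexp _ hLK)
  have hVeq : (S * exp ((-(1 / 2) : ℂ) • a)) ⊗ₖ (T * exp ((-(1 / 2) : ℂ) • b)) =
      (S ⊗ₖ T) * exp ((-(1 / 2) : ℂ) • L) := by
    rw [exp_smul_kronSum, Matrix.mul_kronecker_mul]
  have h1 := hA _ hU _ hV
  rw [hVeq] at h1
  have h2 := h1 (hSJ.mul_left (hcexp _ hLJ)) (hSK.mul_left (hcexp _ hLK))
  have h3 : S ⊗ₖ T = (S ⊗ₖ T) * exp ((-(1 / 2) : ℂ) • L) * exp ((1 / 2 : ℂ) • L) := by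
    rw [mul_assoc, ← Matrix.exp_add_of_commute _ _
      (((Commute.refl L).smul_left _).smul_right _), ← add_smul]
    norm_num
  rw [h3]
  exact h2.mul_left (hcexp _ hLA)

/-! ### Positivity and supports of Choi matrices -/

theorem cstarMatrix_single_nonneg :
    0 ≤ CStarMatrix.ofMatrix (Matrix.of fun i j : X => Matrix.single i j (1 : ℂ)) := by
  -- Each entry of C* C is a sum of |X| equal terms; the scale 1/√|X| normalizes it.
  set c : ℂ := (((Real.sqrt (Fintype.card X))⁻¹ : ℝ) : ℂ) with hc
  set C := CStarMatrix.ofMatrix (Matrix.of fun i j : X => c • Matrix.single i j (1 : ℂ)) with hC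
  suffices h : CStarMatrix.ofMatrix (Matrix.of fun i j : X => Matrix.single i j (1 : ℂ)) =
      star C * C by
    rw [h]; exact star_mul_self_nonneg C
  refine CStarMatrix.ext fun i j => ?_
  have : Nonempty X := ⟨i⟩
  have hcc : (Fintype.card X : ℂ) * (c * c) = 1 := by
    have h : (Fintype.card X : ℝ) * ((Real.sqrt (Fintype.card X))⁻¹ *
        (Real.sqrt (Fintype.card X))⁻¹) = 1 := by
      rw [← mul_inv, Real.mul_self_sqrt (by positivity), mul_inv_cancel₀ (by positivity)]
    rw [hc]
    exact_mod_cast h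
  have hsc : star c = c := by simp [hc]
  have e : ∀ k : X, star (c • Matrix.single k i (1 : ℂ)) * (c • Matrix.single k j (1 : ℂ)) =
      (c * c) • Matrix.single i j (1 : ℂ) := by
    intro k
    rw [star_smul, hsc, Matrix.star_eq_conjTranspose, Matrix.conjTranspose_single, star_one,
      smul_mul_smul_comm, Matrix.single_mul_single_same, one_mul]
  have h := Finset.sum_congr (rfl : (Finset.univ : Finset X) = Finset.univ) fun k _ => e k
  rw [Finset.sum_const, Finset.card_univ, ← Nat.cast_smul_eq_nsmul ℂ, smul_smul, hcc,
    one_smul] at h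
  rw [CStarMatrix.mul_apply]
  exact h.symm

/-- Nonnegative elements are sums of D* D, and flattening block matrices respects products and
adjoints. -/
theorem uncurry_nonneg_of_cstarMatrix_nonneg {B : CStarMatrix X X (Matrix Y Y ℂ)} (hB : 0 ≤ B) :
    0 ≤ (Matrix.of fun p q => B p.1 q.1 p.2 q.2 : Matrix (X × Y) (X × Y) ℂ) := by
  rw [StarOrderedRing.nonneg_iff] at hB
  induction hB using AddSubmonoid.closure_induction with
  | mem B hB =>
    obtain ⟨D, rfl⟩ := hB
    let C : Matrix (X × Y) (X × Y) ℂ := Matrix.of fun p q => D p.1 q.1 p.2 q.2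
    refine (star_mul_self_nonneg C).trans_eq ?_
    ext p q
    change (star C * C) p q = (star D * D) p.1 q.1 p.2 q.2
    rw [CStarMatrix.mul_apply, Matrix.sum_apply, Matrix.mul_apply,
      Fintype.sum_prod_type]
    rfl
  | zero => exact le_rfl
  | add B B' _ _ h h' => exact add_nonneg h h'

theorem choi_nonneg (N : Matrix X X ℂ →CP Matrix Y Y ℂ) : 0 ≤ choi N.toLinearMap :=
  uncurry_nonneg_of_cstarMatrix_nonneg
    (CompletelyPositiveMap.map_cstarMatrix_nonneg N _ (cstarMatrix_single_nonneg (X := X)))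

theorem mul_eq_zero_of_supp_le {J K Z : Matrix n n ℂ} (h : supp J ≤ supp K) (hZ : K * Z = 0) :
    J * Z = 0 := by
  have hker : LinearMap.ker (Matrix.toEuclideanLin K) ≤ LinearMap.ker (Matrix.toEuclideanLin J) := by
    have := Submodule.orthogonal_le h
    rwa [supp, supp, Submodule.orthogonal_orthogonal, Submodule.orthogonal_orthogonal] at this
  ext i j
  have hK : WithLp.toLp 2 (fun i => Z i j) ∈ LinearMap.ker (Matrix.toEuclideanLin K) := by
    rw [LinearMap.mem_ker]
    ext i
    exact congrFun₂ hZ i j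
  have hJ := LinearMap.mem_ker.mp (hker hK)
  exact congrFun (congrArg WithLp.ofLp hJ) i

theorem exists_mul_mul_self_eq (K : Matrix n n ℂ) (hK : IsSelfAdjoint K) :
    ∃ R : Matrix n n ℂ, IsSelfAdjoint R ∧ K * (R * K) = K := by
  have hc : ∀ f : ℝ → ℝ, ContinuousOn f (spectrum ℝ K) := fun f =>
    (Matrix.finite_real_spectrum (A := K)).continuousOn f
  -- Since `0⁻¹ = 0`, this is the Moore-Penrose inverse of K.
  refine ⟨cfc (fun x : ℝ => x⁻¹) K, cfc_predicate _ K, ?_⟩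
  have h : cfc (fun x : ℝ => x * (x⁻¹ * x)) K = K := by
    have e : (fun x : ℝ => x * (x⁻¹ * x)) = fun x => x := by
      ext x
      by_cases hx : x = 0
      · simp [hx]
      · rw [inv_mul_cancel₀ hx, mul_one]
    rw [e, cfc_id' ℝ K]
  rwa [cfc_mul _ _ K (hc _) (hc _), cfc_mul _ _ K (hc _) (hc _), cfc_id' ℝ K] at h

theorem mul_self_le_norm_smul {K : Matrix n n ℂ} (hK : 0 ≤ K) : K * K ≤ ‖K‖ • K := by
  have hs := CFC.sqrt_mul_sqrt_self K hK
  have h := conjugate_le_conjugate_of_nonneg hK.isSelfAdjoint.le_algebraMap_norm_self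
    (CFC.sqrt_nonneg K)
  rw [Algebra.algebraMap_eq_smul_one, mul_smul_comm, mul_one, smul_mul_assoc, hs] at h
  calc K * K = CFC.sqrt K * (CFC.sqrt K * CFC.sqrt K) * CFC.sqrt K := by
        nth_rw 1 2 [← hs]; simp only [mul_assoc]
    _ ≤ _ := by rwa [hs]

/-- With R the pseudo-inverse of K, J = K (R J R) K ≤ ‖R J R‖ K² ≤ ‖R J R‖ ‖K‖ K. -/
theorem exists_le_smul_of_supp_le {J K : Matrix n n ℂ} (hJ : 0 ≤ J) (hK : 0 ≤ K)
    (h : supp J ≤ supp K) : ∃ c : ℝ, 0 ≤ c ∧ J ≤ c • K := by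
  obtain ⟨R, hR, hKRK⟩ := exists_mul_mul_self_eq K hK.isSelfAdjoint
  have h1 : J * (R * K) = J := by
    have := mul_eq_zero_of_supp_le h (Z := 1 - R * K) (by rw [mul_sub, mul_one, hKRK, sub_self])
    rw [mul_sub, mul_one, sub_eq_zero] at this
    exact this.symm
  have h2 : K * R * J = J := by
    have := congrArg star h1
    rwa [star_mul, star_mul, hR.star_eq, hK.isSelfAdjoint.star_eq, hJ.isSelfAdjoint.star_eq] at this
  have hW : IsSelfAdjoint (R * J * R) := by
    rw [IsSelfAdjoint, star_mul, star_mul, hR.star_eq, hJ.isSelfAdjoint.star_eq, mul_assoc]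
  refine ⟨‖R * J * R‖ * ‖K‖, by positivity, ?_⟩
  calc J = K * (R * J * R) * K := by
        conv_lhs => rw [← h2, ← h1]
        simp only [mul_assoc]
    _ ≤ K * algebraMap ℝ _ ‖R * J * R‖ * K :=
        conjugate_le_conjugate_of_nonneg hW.le_algebraMap_norm_self hK
    _ = ‖R * J * R‖ • (K * K) := by
        rw [Algebra.algebraMap_eq_smul_one, mul_smul_comm, mul_one, smul_mul_assoc]
    _ ≤ ‖R * J * R‖ • ‖K‖ • K :=
        smul_le_smul_of_nonneg_left (mul_self_le_norm_smul hK) (norm_nonneg _)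
    _ = _ := smul_smul _ _ _

/-! ### Tensor powers -/

theorem star_piKron {k : ℕ} (R : Fin k → Matrix X X ℂ) :
    star (piKron R) = piKron fun i => star (R i) := by
  ext x x'
  simp [piKron, Matrix.star_apply]

theorem piKron_nonneg {k : ℕ} {R : Fin k → Matrix X X ℂ} (hR : ∀ i, 0 ≤ R i) :
    0 ≤ piKron R := by
  choose S hS using fun i => CStarAlgebra.nonneg_iff_eq_star_mul_self.mp (hR i)
  have h : piKron R = star (piKron S) * piKron S := by
    rw [star_piKron, piKron_mul]
    exact congrArg piKron (funext hS)
  rw [h]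
  exact star_mul_self_nonneg _

theorem piKron_sum {k : ℕ} {ι : Type*} [Fintype ι] [DecidableEq ι] (F : ι → Matrix X X ℂ) :
    piKron (fun _ : Fin k => ∑ b, F b) = ∑ p : Fin k → ι, piKron fun i => F (p i) := by
  ext x x'
  simp only [piKron, Matrix.of_apply, Matrix.sum_apply, Finset.prod_univ_sum,
    Fintype.piFinset_univ]

/-- Expanding the tensor power of K = J + (K - J) gives a sum of positive semidefinite terms, one of
which is the tensor power of J. -/
theorem piKron_le_piKron {k : ℕ} {J K : Matrix X X ℂ} (hJ : 0 ≤ J) (h : J ≤ K) :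
    piKron (fun _ : Fin k => J) ≤ piKron fun _ => K := by
  have e := piKron_sum (k := k) fun b : Bool => cond b J (K - J)
  rw [Fintype.sum_bool, cond_true, cond_false, add_sub_cancel] at e
  rw [e]
  rw [← Finset.add_sum_erase Finset.univ _ (Finset.mem_univ fun _ => true)]
  refine le_add_of_nonneg_right (Finset.sum_nonneg fun p _ => piKron_nonneg fun i => ?_)
  cases p i
  · exact sub_nonneg.mpr h
  · exact hJ

theorem piKron_smul {k : ℕ} (c : ℝ) (K : Matrix X X ℂ) :
    piKron (fun _ : Fin k => c • K) = c ^ k • piKron fun _ => K := by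
  ext x x'
  simp [piKron, Finset.prod_mul_distrib]

/-- The rearrangement `X^{⊗k} ⊗ Y^{⊗k} ≃ (X ⊗ Y)^{⊗k}` of the index sets. -/
def pairPi (k : ℕ) (X Y : Type*) : (Fin k → X) × (Fin k → Y) ≃ (Fin k → X × Y) where
  toFun p i := (p.1 i, p.2 i)
  invFun z := (fun i => (z i).1, fun i => (z i).2)
  left_inv _ := rfl
  right_inv _ := rfl

theorem choi_tensorPow (k : ℕ) (N : Matrix X X ℂ →ₗ[ℂ] Matrix Y Y ℂ) :
    choi (tensorPow k N) =
      (piKron fun _ => choi N).submatrix (pairPi k X Y) (pairPi k X Y) := by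
  ext p q
  have h : Matrix.single p.1 q.1 (1 : ℂ) =
      piKron fun i => Matrix.single (p.1 i) (q.1 i) (1 : ℂ) := by
    ext x x'
    simp only [piKron, Matrix.of_apply, Matrix.single_apply, Finset.prod_ite_zero,
      Finset.prod_const_one, Finset.mem_univ, forall_true_left, funext_iff, forall_and]
  rw [choi, Matrix.of_apply, h, tensorPow_piKron]
  rfl

theorem kronecker_piKron {k : ℕ} (R : Fin k → Matrix X X ℂ) (S : Fin k → Matrix Y Y ℂ) :
    piKron R ⊗ₖ piKron S =
      (piKron fun i => R i ⊗ₖ S i).submatrix (pairPi k X Y) (pairPi k X Y) := by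
  ext p q
  simp [piKron, pairPi, Finset.prod_mul_distrib]

theorem kronecker_permMat {k : ℕ} (π : Equiv.Perm (Fin k)) :
    permMat X π ⊗ₖ permMat Y π =
      (permMat (X × Y) π).submatrix (pairPi k X Y) (pairPi k X Y) := by
  ext p q
  have h : pairPi k X Y p ∘ π = pairPi k X Y q ↔ p.1 ∘ π = q.1 ∧ p.2 ∘ π = q.2 := by
    simp [pairPi, funext_iff, Prod.ext_iff, forall_and]
  simp only [Matrix.kroneckerMap_apply, Matrix.submatrix_apply, permMat_apply, h]
  split_ifs <;> simp_all

theorem tensorRep_wreathRep (k : ℕ) (ρ : G →* Matrix X X ℂ) (τ : G →* Matrix Y Y ℂ)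
    (h : WreathGroup G k) : tensorRep (wreathRep k ρ) (wreathRep k τ) h =
      (wreathRep k (tensorRep ρ τ) h).submatrix (pairPi k X Y) (pairPi k X Y) := by
  change (piKron _ * permMat X h.right) ⊗ₖ (piKron _ * permMat Y h.right) =
    (piKron _ * permMat (X × Y) h.right).submatrix (pairPi k X Y) (pairPi k X Y)
  rw [Matrix.mul_kronecker_mul, kronecker_piKron, kronecker_permMat, Matrix.submatrix_mul_equiv]
  rfl

theorem mem_endAlg_iff {τ : G →* Matrix n n ℂ} {A : Matrix n n ℂ} :
    A ∈ endAlg τ ↔ ∀ g, Commute (τ g) A := by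
  rw [endAlg, Subalgebra.mem_centralizer_iff]
  exact Set.forall_mem_range

theorem piKron_mem_endAlg_wreathRep (k : ℕ) {τ : G →* Matrix X X ℂ} {A : Matrix X X ℂ}
    (hA : A ∈ endAlg τ) : piKron (fun _ => A) ∈ endAlg (wreathRep k τ) := by
  rw [mem_endAlg_iff] at *
  intro h
  change piKron _ * permMat X h.right * _ = _ * (piKron _ * permMat X h.right)
  rw [mul_assoc, permMat_mul_piKron, ← mul_assoc, ← mul_assoc, piKron_mul, piKron_mul]
  congr 2
  exact funext fun i => (hA (h.left i)).eq

theorem choi_tensorPow_mem_endAlg (k : ℕ) {N : Matrix X X ℂ →ₗ[ℂ] Matrix Y Y ℂ}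
    {ρ : G →* Matrix X X ℂ} {τ : G →* Matrix Y Y ℂ} (hN : choi N ∈ endAlg (tensorRep ρ τ)) :
    choi (tensorPow k N) ∈ endAlg (tensorRep (wreathRep k ρ) (wreathRep k τ)) := by
  have h := piKron_mem_endAlg_wreathRep k hN
  rw [mem_endAlg_iff] at *
  intro g
  rw [tensorRep_wreathRep, choi_tensorPow, Commute, SemiconjBy, Matrix.submatrix_mul_equiv,
    Matrix.submatrix_mul_equiv, (h g).eq]

theorem choi_tensorPow_nonneg (k : ℕ) {N : Matrix X X ℂ →ₗ[ℂ] Matrix Y Y ℂ}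
    (hN : 0 ≤ choi N) : 0 ≤ choi (tensorPow k N) := by
  rw [choi_tensorPow]
  exact ((Matrix.nonneg_iff_posSemidef.mp (piKron_nonneg fun _ => hN)).submatrix _).nonneg

theorem choi_tensorPow_le_smul (k : ℕ) {N M : Matrix X X ℂ →ₗ[ℂ] Matrix Y Y ℂ} {c : ℝ}
    (hN : 0 ≤ choi N) (h : choi N ≤ c • choi M) :
    choi (tensorPow k N) ≤ c ^ k • choi (tensorPow k M) := by
  have h1 := piKron_le_piKron (k := k) hN h
  rw [piKron_smul] at h1
  rw [choi_tensorPow, choi_tensorPow]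
  exact (Matrix.le_iff.mp h1).submatrix (pairPi k X Y)

end SharpDivergence

end
open SharpDivergence
theorem mainTheorem8 {X Y G : Type*} [Fintype X] [DecidableEq X] [Fintype Y] [DecidableEq Y]
    [Group G] [Finite G]
    (N M : Matrix X X ℂ →CP Matrix Y Y ℂ) (hN : IsQuantumChannel N) (hM : IsQuantumChannel M)
    (ρX : G →* Matrix X X ℂ) (ρY : G →* Matrix Y Y ℂ)
    (hNG : choi N.toLinearMap ∈ endAlg (tensorRep ρX ρY))
    (hMG : choi M.toLinearMap ∈ endAlg (tensorRep ρX ρY))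
    (hNM : supp (choi N.toLinearMap) ≤ supp (choi M.toLinearMap))
    (α : ℝ) (hα : 1 < α) (k : ℕ) :
    ∃ A ∈ feasible α (choi (tensorPow k N.toLinearMap)) (choi (tensorPow k M.toLinearMap)),
      (∀ B ∈ feasible α (choi (tensorPow k N.toLinearMap)) (choi (tensorPow k M.toLinearMap)),
        ‖traceY A‖ ≤ ‖traceY B‖) ∧
      A ∈ endAlg (tensorRep (wreathRep k ρX) (wreathRep k ρY)) := by
  obtain ⟨c, hc, hle⟩ := exists_le_smul_of_supp_le (choi_nonneg N) (choi_nonneg M) hNM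
  have hJ := choi_tensorPow_nonneg k (choi_nonneg N)
  have hK := choi_tensorPow_nonneg k (choi_nonneg M)
  obtain ⟨A, hA, hopt, hcomm⟩ := exists_optimal_commute_kronecker_unitary hα hK
    (feasible_nonempty hα hK (pow_nonneg hc k) (choi_tensorPow_le_smul k (choi_nonneg N) hle))
  refine ⟨A, hA, hopt, mem_endAlg_iff.mpr fun h => ?_⟩
  -- Each group element acts by a product of two invertible operators, one on each tensor power, so
  -- the polar argument applies to it directly.
  exact commute_kronecker_of_commute_unitary hJ.isSelfAdjoint hK.isSelfAdjoint hcomm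
    ((Group.isUnit h).map (wreathRep k ρX)) ((Group.isUnit h).map (wreathRep k ρY))
    (mem_endAlg_iff.mp (choi_tensorPow_mem_endAlg k hNG) h)
    (mem_endAlg_iff.mp (choi_tensorPow_mem_endAlg k hMG) h)
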